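/- Let $G$ be a finite simple graph and let $k$ be a positive integer. The \emph{$k$-liminal burning game} on $G$ is played in rounds by two players, the Saboteur and the Arsonist. Initially all vertices are unburned and unrevealed. In each round, first every unburned vertex with a burned neighbor becomes burned. Then the Saboteur reveals a set of $k$ vertices that are neither burned nor revealed (all such vertices, if there are fewer than $k$). Then the Arsonist burns one unburned vertex among all vertices revealed so far in the game, if there is one. The game ends after the first round at whose end all vertices are burned. The Saboteur tries to make the game last as long as possible, and the Arsonist tries to end it as soon as possible. The \emph{$k$-liminal burning number} $b_k(G)$ is the number of rounds under optimal play by both players. For a positive integer $n$, let $G_n = P_n \,\square\, P_n$ be the $n \times n$ grid, the Cartesian product of two paths on $n$ vertices. \textbf{Theorem.} For all positive integers $k$ and $n$, \[ b_k(G_n) \;\geq\; \begin{cases} 2n - 2\lfloor \log_2(n+3)\rfloor & \text{if } k=1,\\[2pt] 2n - \frac{3k}{4} - 7 - (2k+3)\ln\left(\frac{2n+2k+3}{3k+7}\right) & \text{if } 2 \leq k < 2n+23,\\[2pt] \frac{n^2+2}{k+2} & \text{if } 2n+23 \leq k < (2/3)^{1/3} n^{4/3},\\[2pt] (3/2)^{1/3}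 n^{2/3} - 1 & \text{if } k \geq (2/3)^{1/3} n^{4/3}. \end{cases} \] For small $n$ the ranges of $k$ may overlap. In that case each of the bounds whose range contains $k$ holds. -/

import Mathlib

namespace LiminalBurning

variable {V : Type*} [Fintype V] [DecidableEq V]

/-- One propagation step: all burned vertices stay burned, and every vertex with a burned
neighbor becomes burned. -/
def propagate (G : SimpleGraph V) [DecidableRel G.Adj] (B : Finset V) : Finset V :=
  B ∪ Finset.univ.filter (fun v => ∃ u ∈ B, G.Adj u v)

/-- A legal reveal of the Saboteur when `B` is the set of burned vertices and `R` the set of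
revealed vertices: a set of exactly `k` vertices that are neither burned nor revealed, or the set
of all such vertices if there are fewer than `k` of them. -/
def IsReveal (k : ℕ) (B R S : Finset V) : Prop :=
  S ⊆ (B ∪ R)ᶜ ∧ S.card = min k ((B ∪ R)ᶜ).card

/-- `EndsWithin G k t B R`: in the `k`-liminal burning game on `G`, when a round is about to begin
with the vertices in `B` burned and those in `R` revealed, the Arsonist can guarantee that
all vertices are burned after at most `t` further rounds.

If all vertices are burned, the game is over. Otherwise a round is played: the fire
propagates; the Saboteur makes a legal reveal `S`; the Arsonist then burns an unburned vertex among
all the vertices revealed so far. If there is no such vertex (which happens only when the propagation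
has burned everything), the Arsonist passes. -/
def EndsWithin (G : SimpleGraph V) [DecidableRel G.Adj] (k : ℕ) :
    ℕ → Finset V → Finset V → Prop
  | 0, B, _ => B = Finset.univ
  | t + 1, B, R => B = Finset.univ ∨
      ∀ S : Finset V, IsReveal k (propagate G B) R S →
        (∃ v ∈ (R ∪ S) \ propagate G B,
          EndsWithin G k t (insert v (propagate G B)) (R ∪ S)) ∨
        ((R ∪ S) \ propagate G B = ∅ ∧ EndsWithin G k t (propagate G B) (R ∪ S))

/-- The `k`-liminal burning number `b_k(G)`: the number of rounds of the game under optimal play,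
that is, the least number of rounds within which the Arsonist can force the game to end when it
starts with no vertex burned or revealed. -/
noncomputable def liminalBurningNumber (G : SimpleGraph V) [DecidableRel G.Adj] (k : ℕ) : ℕ :=
  sInf {t : ℕ | EndsWithin G k t ∅ ∅}

/-- For positive `k` the game always ends within as many rounds as there are unburned vertices, so
the set in the definition of `liminalBurningNumber` is nonempty. -/
theorem endsWithin_of_card_le (G : SimpleGraph V) [DecidableRel G.Adj] {k : ℕ} (hk : 1 ≤ k)
    (t : ℕ) (B R : Finset V) (h : Bᶜ.card ≤ t) : EndsWithin G k t B R := by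
  induction t generalizing B R with
  | zero => simpa [EndsWithin] using h
  | succ t ih =>
    right
    intro S hS
    have hB : B ⊆ propagate G B := Finset.subset_union_left
    by_cases hne : (R ∪ S) \ propagate G B = ∅
    · refine Or.inr ⟨hne, ih _ _ ?_⟩
      suffices hu : propagate G B = Finset.univ by simp [hu]
      by_contra hu
      obtain ⟨v, hv⟩ : ∃ v, v ∉ propagate G B := by
        by_contra hcon
        push Not at hcon
        exact hu (Finset.eq_univ_iff_forall.2 hcon)
      rw [Finset.sdiff_eq_empty_iff_subset] at hne
      have hS0 : S = ∅ := by
        rw [Finset.eq_empty_iff_forall_notMem]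
        intro x hx
        have h1 := hS.1 hx
        have h2 := hne (Finset.mem_union_right R hx)
        simp [h2] at h1
      have hvR : v ∉ R := fun hx => hv (hne (Finset.mem_union_left S hx))
      have hpos : 0 < ((propagate G B ∪ R)ᶜ).card :=
        Finset.card_pos.2 ⟨v, by simp [hv, hvR]⟩
      have hc := hS.2
      rw [hS0, Finset.card_empty] at hc
      omega
    · obtain ⟨v, hv⟩ := Finset.nonempty_iff_ne_empty.2 hne
      refine Or.inl ⟨v, hv, ih _ _ ?_⟩
      have hv' : v ∉ propagate G B := (Finset.mem_sdiff.1 hv).2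
      have hlt : ((insert v (propagate G B))ᶜ).card < Bᶜ.card := by
        apply Finset.card_lt_card
        rw [Finset.ssubset_iff_of_subset
          (Finset.compl_subset_compl.2 (hB.trans (Finset.subset_insert _ _)))]
        exact ⟨v, by simpa using fun hx => hv' (hB hx), by simp⟩
      omega

/-- The square Cartesian grid `G_n`, the Cartesian product of two paths on `n` vertices. -/
def grid (n : ℕ) : SimpleGraph (Fin n × Fin n) :=
  (SimpleGraph.pathGraph n).boxProd (SimpleGraph.pathGraph n)

noncomputable instance (n : ℕ) : DecidableRel (grid n).Adj := Classical.decRel _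

end LiminalBurning

/-!
The Saboteur always reveals the available vertices that come first in the *diagonal order* of the grid:
by `i + j`, and inside a diagonal by `i`. Initial segments of this order are nested and stable under
taking neighborhoods: the closed neighborhood of the initial segment of length `m` lies in the
initial segment of length `grow n m` (`idx_lt_grow_of_adj`). Hence bounds on the game reduce to bounds
on the length of an initial segment containing everything burned or revealed.

* In any round this length passes from `m` to at most `grow n m + k`
  (`le_liminalBurningNumber_of_grow`). For `k = 1` the resulting orbit is computed exactly: the fire
  gains one round on the diagonals each time the index of the diagonal roughly doubles (in the
  growing half of the grid), or its length is roughly halved (in the shrinking half); see `rounds_of_growing` and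
  `rounds_of_shrinking`. For `2 ≤ k ≤ 20` each vertex is given a weight, depending on its diagonal,
  such that the weight covered grows by at most one per round (`sum_le_liminalBurningNumber_of_small`).

* For `k ≥ 21` it matters that fires have to start from a burned vertex. A fire just lit can leave
  the revealed region in the next round at two vertices only, and all other fires are confined to the
  neighborhood of the region of the round before. So the length passes either from `m` to at most
  `m + k + 2` in one round, or from `m` to at most `grow n (grow n m) + k + 2` in two rounds, or to
  `grow n m` (`le_liminalBurningNumber_of_potential`). Again a weight turns this into a lower bound
  (`sum_le_liminalBurningNumber_of_large`). If `k ≥ 2 * n + 17`, all weights equal `1 / (k + 2)`, which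
  gives the bound `(n ^ 2 + 2) / (k + 2)`.

* The sums of weights are compared with the logarithmic bound by induction on `n`: the increments
  of the bound are at most `(2 * n + 1) / (n + k + 2)` (`logBound_add_one_le`). For `k ≥ 21` the
  induction starts at the least `n` with `k < 2 * n + 23`, where the sum is `n ^ 2 / (k + 2)`.

* The bound for the largest `k` holds for all `k`: after `t` rounds the fire is covered by balls of
  radii `0, 1, …, t - 1`, and balls of radius `r` have at most `(r + 1) ^ 2 + r ^ 2` vertices.
-/

namespace LiminalBurning

/-! ### The diagonal order on the grid -/

section Order

/-- The number of vertices `(i, j)` of the `n × n` grid on the diagonal `i + j = s`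
(for `s ≤ 2 * n - 2`, and `0` beyond). -/
def diagLen (n s : ℕ) : ℕ := min (s + 1) (2 * n - 1 - s)

/-- The number of vertices of the grid on the diagonals before diagonal `s`. -/
def diagStart (n s : ℕ) : ℕ := ∑ r ∈ Finset.range s, diagLen n r

/-- The diagonal containing the vertex in position `p` of the diagonal order (with the last diagonal
as the value for positions outside the grid). -/
def diagOf (n p : ℕ) : ℕ := Nat.findGreatest (fun s => diagStart n s ≤ p) (2 * n - 2)

/-- The position of a vertex in the diagonal order: diagonals one after the other, and each diagonal
by increasing first coordinate. -/
def idx {n : ℕ} (v : Fin n × Fin n) : ℕ :=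
  diagStart n (v.1 + v.2) + min (v.1 : ℕ) (n - 1 - v.2)

/-- The first `m` vertices of the grid in the diagonal order. -/
def initSeg (n m : ℕ) : Finset (Fin n × Fin n) := Finset.univ.filter (fun v => idx v < m)

/-- The furthest that a neighbor can lie after a vertex of diagonal `s` in the diagonal order: one
more than the number of vertices of the diagonal in the growing half, where the next diagonal is
longer, and that number in the shrinking half. -/
def reach (n s : ℕ) : ℕ := min (s + 2) (2 * n - 1 - s)

/-- The length of an initial segment that contains the closed neighborhood of the initial
segment of length `m`. -/
def grow (n m : ℕ) : ℕ := if m = 0 then 0 else m + reach n (diagOf n (m - 1))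

theorem diagStart_succ (n s : ℕ) : diagStart n (s + 1) = diagStart n s + diagLen n s :=
  Finset.sum_range_succ _ _

theorem diagStart_mono (n : ℕ) : Monotone (diagStart n) :=
  monotone_nat_of_le_succ fun s => by rw [diagStart_succ]; omega

theorem two_mul_diagStart_of_le {n s : ℕ} (h : s ≤ n) : 2 * diagStart n s = s * (s + 1) := by
  induction s with
  | zero => simp [diagStart]
  | succ s ih =>
    have h1 : diagLen n s = s + 1 := by unfold diagLen; omega
    rw [diagStart_succ, h1, mul_add, ih (by omega)]
    ring

theorem two_mul_diagStart_of_ge {n l : ℕ} (h : l < n) :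
    2 * diagStart n (2 * n - 1 - l) + l * (l + 1) = 2 * n ^ 2 := by
  obtain ⟨d, rfl⟩ : ∃ d, n = l + 1 + d := ⟨n - (l + 1), by omega⟩
  induction d generalizing l with
  | zero =>
    have h1 : 2 * (l + 1 + 0) - 1 - l = l + 1 + 0 := by omega
    rw [h1, two_mul_diagStart_of_le le_rfl]
    ring
  | succ d ih =>
    have h2 := ih (l := l + 1) (by omega)
    have e : l + 1 + 1 + d = l + 1 + (d + 1) := by ring
    rw [e] at h2
    have h3 : 2 * (l + 1 + (d + 1)) - 1 - l = 2 * (l + 1 + (d + 1)) - 1 - (l + 1) + 1 := by omega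
    have h4 : diagLen (l + 1 + (d + 1)) (2 * (l + 1 + (d + 1)) - 1 - (l + 1)) = l + 1 := by
      unfold diagLen; omega
    rw [h3, diagStart_succ, h4]
    nlinarith [h2]

theorem diagStart_last {n : ℕ} (hn : 1 ≤ n) : diagStart n (2 * n - 1) = n ^ 2 := by
  have := two_mul_diagStart_of_ge (n := n) (l := 0) hn
  simp only [Nat.sub_zero, zero_mul, add_zero] at this
  omega

theorem diagOf_diagStart_add {n s x : ℕ} (hs : s ≤ 2 * n - 2) (hx : x < diagLen n s) :
    diagOf n (diagStart n s + x) = s := by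
  unfold diagOf
  rw [Nat.findGreatest_eq_iff]
  refine ⟨hs, fun _ => Nat.le_add_right _ _, fun r hr _ h => ?_⟩
  have := diagStart_mono n (Nat.succ_le_of_lt hr)
  rw [Nat.succ_eq_add_one, diagStart_succ] at this
  omega

theorem diagOf_le (n p : ℕ) : diagOf n p ≤ 2 * n - 2 := Nat.findGreatest_le _

theorem diagStart_diagOf_le (n p : ℕ) : diagStart n (diagOf n p) ≤ p :=
  Nat.findGreatest_spec (P := fun s => diagStart n s ≤ p) (m := 0) (Nat.zero_le _)
    (by simp [diagStart])

theorem lt_diagStart_diagOf_succ {n p : ℕ} (hp : p < n ^ 2) :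
    p < diagStart n (diagOf n p + 1) := by
  have hn : 1 ≤ n := by
    rcases Nat.eq_zero_or_pos n with rfl | h
    · simp at hp
    · exact h
  by_contra hcon
  push Not at hcon
  rcases Nat.lt_or_ge (diagOf n p) (2 * n - 2) with h | h
  · exact Nat.findGreatest_is_greatest (P := fun s => diagStart n s ≤ p)
      (Nat.lt_succ_self (diagOf n p)) h hcon
  · have h1 : diagOf n p + 1 = 2 * n - 1 := by have := diagOf_le n p; omega
    rw [h1, diagStart_last hn] at hcon
    omega

theorem diagOf_mono (n : ℕ) : Monotone (diagOf n) := fun _ _ h =>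
  Nat.findGreatest_mono (fun _ hs => le_trans hs h) le_rfl

theorem diagOf_lt_of_lt_diagStart {n p s : ℕ} (h : p < diagStart n s) : diagOf n p < s := by
  by_contra hcon
  push Not at hcon
  have := (diagStart_mono n hcon).trans (diagStart_diagOf_le n p)
  omega

variable {n : ℕ}

theorem offset_lt_diagLen (v : Fin n × Fin n) :
    min (v.1 : ℕ) (n - 1 - v.2) < diagLen n (v.1 + v.2) := by
  have h1 := v.1.2
  have h2 := v.2.2
  unfold diagLen
  omega

theorem diagOf_idx (v : Fin n × Fin n) : diagOf n (idx v) = v.1 + v.2 :=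
  diagOf_diagStart_add (by have := v.1.2; have := v.2.2; omega) (offset_lt_diagLen v)

theorem idx_lt_diagStart_succ (v : Fin n × Fin n) : idx v < diagStart n (v.1 + v.2 + 1) := by
  rw [diagStart_succ]
  have := offset_lt_diagLen v
  unfold idx
  omega

theorem idx_lt (v : Fin n × Fin n) : idx v < n ^ 2 := by
  have h1 := v.1.2
  have h2 := v.2.2
  rw [← diagStart_last (by omega : 1 ≤ n)]
  exact (idx_lt_diagStart_succ v).trans_le (diagStart_mono n (by omega))

theorem idx_injective : Function.Injective (idx : Fin n × Fin n → ℕ) := by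
  intro u v h
  have hs : (u.1 + u.2 : ℕ) = v.1 + v.2 := by rw [← diagOf_idx, ← diagOf_idx, h]
  unfold idx at h
  rw [hs] at h
  have hu1 := u.1.2
  have hu2 := u.2.2
  have hv1 := v.1.2
  have hv2 := v.2.2
  ext <;> omega

theorem card_initSeg (n m : ℕ) : (initSeg n m).card = min m (n ^ 2) := by
  have huniv : (Finset.univ : Finset (Fin n × Fin n)).image idx = Finset.range (n ^ 2) := by
    apply Finset.eq_of_subset_of_card_le
    · intro p hp
      obtain ⟨v, -, rfl⟩ := Finset.mem_image.1 hp
      exact Finset.mem_range.2 (idx_lt v)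
    · rw [Finset.card_image_of_injective _ idx_injective]
      simp [sq]
  have h : (initSeg n m).image idx = Finset.range (min m (n ^ 2)) := by
    ext p
    rw [Finset.mem_range, lt_min_iff, ← Finset.mem_range (m := p) (n := n ^ 2), ← huniv]
    simp only [initSeg, Finset.mem_image, Finset.mem_filter, Finset.mem_univ, true_and]
    constructor
    · rintro ⟨v, hv, rfl⟩
      exact ⟨hv, v, rfl⟩
    · rintro ⟨hp, v, rfl⟩
      exact ⟨v, hp, rfl⟩
  rw [← Finset.card_image_of_injective _ idx_injective, h, Finset.card_range]

theorem mem_initSeg {m : ℕ} {v : Fin n × Fin n} : v ∈ initSeg n m ↔ idx v < m := by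
  simp [initSeg]

theorem initSeg_mono (n : ℕ) : Monotone (initSeg n) := fun _ _ h _ hv =>
  mem_initSeg.2 ((mem_initSeg.1 hv).trans_le h)

theorem initSeg_eq_univ {m : ℕ} (h : n ^ 2 ≤ m) : initSeg n m = Finset.univ :=
  Finset.eq_univ_iff_forall.2 fun v => mem_initSeg.2 ((idx_lt v).trans_le h)

theorem grid_adj {u v : Fin n × Fin n} :
    (grid n).Adj u v ↔
      (((u.1 : ℕ) + 1 = v.1 ∨ (v.1 : ℕ) + 1 = u.1) ∧ u.2 = v.2) ∨
      (((u.2 : ℕ) + 1 = v.2 ∨ (v.2 : ℕ) + 1 = u.2) ∧ u.1 = v.1) := by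
  unfold grid
  rw [SimpleGraph.boxProd_adj, SimpleGraph.pathGraph_adj, SimpleGraph.pathGraph_adj]

theorem idx_lt_of_diag_lt {u v : Fin n × Fin n} (h : (u.1 + u.2 : ℕ) < v.1 + v.2) :
    idx u < idx v :=
  (idx_lt_diagStart_succ u).trans_le
    ((diagStart_mono n (Nat.succ_le_of_lt h)).trans (Nat.le_add_right _ _))

theorem idx_le_of_adj {u v : Fin n × Fin n} (h : (grid n).Adj u v) :
    idx v ≤ idx u + reach n (u.1 + u.2) := by
  have hu1 := u.1.2
  have hu2 := u.2.2
  have hv1 := v.1.2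
  have hv2 := v.2.2
  rw [grid_adj] at h
  rcases Nat.lt_or_ge (v.1 + v.2 : ℕ) (u.1 + u.2) with hlt | hge
  · have := idx_lt_of_diag_lt hlt
    omega
  · have hs : (v.1 + v.2 : ℕ) = u.1 + u.2 + 1 := by
      rcases h with ⟨h | h, h'⟩ | ⟨h | h, h'⟩ <;> (have := congrArg Fin.val h'; omega)
    unfold idx
    rw [hs, diagStart_succ]
    unfold diagLen reach
    rcases h with ⟨h | h, h'⟩ | ⟨h | h, h'⟩ <;> (have := congrArg Fin.val h'; omega)

theorem monotone_add_reach (n : ℕ) {p q : ℕ} (h : p ≤ q) (hq : q < n ^ 2) :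
    p + reach n (diagOf n p) ≤ q + reach n (diagOf n q) := by
  have hle := diagOf_mono n h
  have hb := diagOf_le n q
  have h1 := diagStart_diagOf_le n q
  have h2 := lt_diagStart_diagOf_succ (h.trans_lt hq)
  rcases hle.eq_or_lt with he | hlt
  · rw [he]
    omega
  -- From one diagonal to the next, `reach` drops by at most one, and every diagonal skipped
  -- contains at least one position, which makes up for the loss.
  · rcases Nat.lt_or_ge (diagOf n p + 1) (diagOf n q) with h3 | h3
    · have h4 : diagStart n (diagOf n p + 1) + (diagOf n q - (diagOf n p + 1)) ≤
          diagStart n (diagOf n q) := by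
        obtain ⟨d, hd⟩ : ∃ d, diagOf n q = diagOf n p + 1 + d :=
          ⟨diagOf n q - (diagOf n p + 1), by omega⟩
        rw [hd] at hb ⊢
        clear hd h3 hlt
        induction d with
        | zero => simp
        | succ d ih =>
          have := ih (by omega)
          rw [← add_assoc, diagStart_succ n (diagOf n p + 1 + d)]
          have : 1 ≤ diagLen n (diagOf n p + 1 + d) := by unfold diagLen; omega
          omega
      unfold reach
      omega
    · have h4 : diagOf n q = diagOf n p + 1 := by omega
      rw [h4] at h1 ⊢
      unfold reach
      omega

theorem le_grow (n m : ℕ) : m ≤ grow n m := by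
  unfold grow
  split_ifs <;> omega

/-- The closed neighborhood of an initial segment lies in the initial segment given by `grow`. -/
theorem idx_lt_grow_of_adj {m : ℕ} {u v : Fin n × Fin n} (hu : idx u < m)
    (h : (grid n).Adj u v) : idx v < grow n m := by
  have h0 : m ≠ 0 := by omega
  unfold grow
  rw [if_neg h0]
  have h1 := idx_le_of_adj h
  rw [← diagOf_idx] at h1
  rcases Nat.lt_or_ge (m - 1) (n ^ 2) with h2 | h2
  · have := monotone_add_reach n (by omega : idx u ≤ m - 1) h2
    omega
  · have := idx_lt v
    omega

/-- The neighbors of `u` beyond an initial segment containing `u` are on the next diagonal. -/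
theorem card_neighbors_sdiff_initSeg_le {m : ℕ} {u : Fin n × Fin n} (hu : idx u < m) :
    (Finset.univ.filter (fun v => (grid n).Adj u v ∧ m ≤ idx v)).card ≤ 2 := by
  have hinj : Set.InjOn (fun v : Fin n × Fin n => (v.1 : ℕ) - u.1)
      (Finset.univ.filter (fun v => (grid n).Adj u v ∧ m ≤ idx v) : Finset (Fin n × Fin n)) := by
    intro v hv w hw hvw
    simp only [Finset.mem_coe, Finset.mem_filter, Finset.mem_univ, true_and] at hv hw hvw
    have fwd : ∀ x : Fin n × Fin n, (grid n).Adj u x ∧ m ≤ idx x →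
        (u.1 + u.2 : ℕ) ≤ x.1 + x.2 := by
      intro x hx
      by_contra hcon
      have := idx_lt_of_diag_lt (not_le.1 hcon)
      omega
    have hv1 := fwd v hv
    have hw1 := fwd w hw
    have hv2 := grid_adj.1 hv.1
    have hw2 := grid_adj.1 hw.1
    ext <;>
    rcases hv2 with ⟨h | h, h'⟩ | ⟨h | h, h'⟩ <;> rcases hw2 with ⟨g | g, g'⟩ | ⟨g | g, g'⟩ <;>
      (have := congrArg Fin.val h'; have := congrArg Fin.val g'; omega)
  calc _ ≤ (Finset.range 2).card := by
        refine Finset.card_le_card_of_injOn _ ?_ hinj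
        intro v hv
        simp only [Finset.mem_coe, Finset.mem_filter, Finset.mem_univ, true_and] at hv
        have hv2 := grid_adj.1 hv.1
        simp only [Finset.coe_range, Set.mem_Iio]
        rcases hv2 with ⟨h | h, h'⟩ | ⟨h | h, h'⟩ <;> (have := congrArg Fin.val h'; omega)
    _ = 2 := by simp

end Order

/-! ### Invariants of the game -/

section Game

/-- A lower bound for the burning number from an invariant `P t B R` of the positions after `t` rounds
that the Saboteur can maintain. -/
theorem le_liminalBurningNumber {V : Type*} [Fintype V] [DecidableEq V] (G : SimpleGraph V)
    [DecidableRel G.Adj] {k : ℕ} (hk : 1 ≤ k) (x : ℝ) (P : ℕ → Finset V → Finset V → Prop)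
    (h0 : P 0 ∅ ∅)
    (hstep : ∀ t B R, P t B R → ∃ S, IsReveal k (propagate G B) R S ∧
      (∀ v ∈ R ∪ S, P (t + 1) (insert v (propagate G B)) (R ∪ S)) ∧
      P (t + 1) (propagate G B) (R ∪ S))
    (hend : ∀ t R, P t Finset.univ R → x ≤ t) :
    x ≤ (liminalBurningNumber G k : ℝ) := by
  have key : ∀ τ t B R, P t B R → EndsWithin G k τ B R → x ≤ ((t + τ : ℕ) : ℝ) := by
    intro τ
    induction τ with
    | zero =>
      intro t B R hP hE
      obtain rfl : B = Finset.univ := hE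
      exact hend t R hP
    | succ τ ih =>
      intro t B R hP hE
      rcases hE with rfl | hE
      · refine (hend t R hP).trans ?_
        exact_mod_cast Nat.le_add_right t (τ + 1)
      · obtain ⟨S, hS, h1, h2⟩ := hstep t B R hP
        have e : t + (τ + 1) = t + 1 + τ := by ring
        rw [e]
        rcases hE S hS with ⟨v, hv, hv'⟩ | ⟨-, h⟩
        · exact ih _ _ _ (h1 v (Finset.mem_sdiff.1 hv).1) hv'
        · exact ih _ _ _ h2 h
  have hmem : liminalBurningNumber G k ∈ {t : ℕ | EndsWithin G k t ∅ ∅} :=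
    Nat.sInf_mem ⟨_, endsWithin_of_card_le G hk _ ∅ ∅ le_rfl⟩
  simpa using key _ 0 ∅ ∅ h0 hmem

theorem mem_propagate {V : Type*} [Fintype V] [DecidableEq V] {G : SimpleGraph V}
    [DecidableRel G.Adj] {B : Finset V} {v : V} :
    v ∈ propagate G B ↔ v ∈ B ∨ ∃ u ∈ B, G.Adj u v := by
  simp [propagate]

variable {n : ℕ}

theorem propagate_subset_grow {B : Finset (Fin n × Fin n)} {m : ℕ} (h : B ⊆ initSeg n m) :
    propagate (grid n) B ⊆ initSeg n (grow n m) := by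
  intro v hv
  rcases mem_propagate.1 hv with hv | ⟨u, hu, huv⟩
  · exact initSeg_mono n (le_grow n m) (h hv)
  · exact mem_initSeg.2 (idx_lt_grow_of_adj (mem_initSeg.1 (h hu)) huv)

/-- The Saboteur can reveal the available vertices that come first in the diagonal order. If at
most `c` of the burned or revealed vertices lie outside the initial segment of length `m`, this
reveal lies in the initial segment of length `m + c + k`. -/
theorem exists_isReveal_subset_initSeg (k : ℕ) (B R : Finset (Fin n × Fin n)) :
    ∃ S, IsReveal k B R S ∧
      ∀ m c, ((B ∪ R) \ initSeg n m).card ≤ c → S ⊆ initSeg n (m + c + k) := by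
  classical
  set C := (B ∪ R)ᶜ with hC
  -- The reveal is the part of `C` in the shortest initial segment that contains enough of it.
  have hex : ∃ a, min k C.card ≤ (C ∩ initSeg n a).card :=
    ⟨n ^ 2, by rw [initSeg_eq_univ le_rfl, Finset.inter_univ]; exact min_le_right _ _⟩
  have hcard : (C ∩ initSeg n (Nat.find hex)).card = min k C.card := by
    refine le_antisymm ?_ (Nat.find_spec hex)
    rcases h : Nat.find hex with _ | a
    · simp [initSeg]
    · have h1 := Nat.find_min hex (m := a) (by omega)
      have h2 : (C ∩ initSeg n (a + 1)).card ≤ (C ∩ initSeg n a).card + 1 := by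
        have h3 : C ∩ initSeg n (a + 1) ⊆
            (C ∩ initSeg n a) ∪ Finset.univ.filter (fun v => idx v = a) := by
          intro v hv
          simp only [Finset.mem_inter, mem_initSeg, Finset.mem_union, Finset.mem_filter,
            Finset.mem_univ, true_and] at hv ⊢
          rcases Nat.lt_succ_iff_lt_or_eq.1 hv.2 with h | h
          · exact Or.inl ⟨hv.1, h⟩
          · exact Or.inr h
        have h4 : (Finset.univ.filter (fun v : Fin n × Fin n => idx v = a)).card ≤ 1 := by
          rw [Finset.card_le_one]
          intro u hu v hv
          simp only [Finset.mem_filter, Finset.mem_univ, true_and] at hu hv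
          exact idx_injective (hu.trans hv.symm)
        exact (Finset.card_le_card h3).trans ((Finset.card_union_le _ _).trans (by omega))
      omega
  refine ⟨C ∩ initSeg n (Nat.find hex), ⟨Finset.inter_subset_left, hcard⟩, fun m c hc => ?_⟩
  refine Finset.inter_subset_right.trans (initSeg_mono n (Nat.find_min' hex ?_))
  rcases Nat.lt_or_ge (m + c + k) (n ^ 2) with hlt | hge
  · have h1 := card_initSeg n (m + c + k)
    have h2 := card_initSeg n m
    have h3 : initSeg n (m + c + k) ⊆
        (C ∩ initSeg n (m + c + k)) ∪ (initSeg n m ∪ ((B ∪ R) \ initSeg n m)) := by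
      intro v hv
      by_cases hv' : v ∈ B ∪ R <;> by_cases hvm : v ∈ initSeg n m <;> simp_all
    have h4 := Finset.card_le_card h3
    have h5 := Finset.card_union_le (C ∩ initSeg n (m + c + k))
      (initSeg n m ∪ ((B ∪ R) \ initSeg n m))
    have h6 := Finset.card_union_le (initSeg n m) ((B ∪ R) \ initSeg n m)
    omega
  · rw [initSeg_eq_univ hge, Finset.inter_univ]
    exact min_le_right _ _

theorem sq_le_of_univ_subset_initSeg {m : ℕ} (h : Finset.univ ⊆ initSeg n m) : n ^ 2 ≤ m := by
  have h1 := Finset.card_le_card h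
  rw [card_initSeg] at h1
  simp only [Finset.card_univ, Fintype.card_prod, Fintype.card_fin] at h1
  rw [sq] at h1 ⊢
  exact h1.trans (min_le_left _ _)

/-- The burned and revealed vertices stay within initial segments whose lengths follow
`m ↦ grow n m + k`. -/
theorem le_liminalBurningNumber_of_grow {k : ℕ} (hk : 1 ≤ k) (x : ℝ) (a : ℕ → ℕ)
    (ha : ∀ t, a (t + 1) = grow n (a t) + k) (hx : ∀ t, n ^ 2 ≤ a t → x ≤ t) :
    x ≤ (liminalBurningNumber (grid n) k : ℝ) := by
  refine le_liminalBurningNumber (grid n) hk x (fun t B R => B ∪ R ⊆ initSeg n (a t))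
    (by simp) ?_ ?_
  · intro t B R h
    obtain ⟨S, hS, hsub⟩ := exists_isReveal_subset_initSeg k (propagate (grid n) B) R
    have hB := propagate_subset_grow (Finset.union_subset_left h)
    have hR : R ⊆ initSeg n (grow n (a t)) :=
      (Finset.union_subset_right h).trans (initSeg_mono n (le_grow n _))
    have hC := Finset.union_subset hB hR
    have hS' : S ⊆ initSeg n (a (t + 1)) := by
      have := hsub (grow n (a t)) 0 (by rw [Finset.sdiff_eq_empty_iff_subset.2 hC]; simp)
      rwa [add_zero, ← ha] at this
    have hmono : initSeg n (grow n (a t)) ⊆ initSeg n (a (t + 1)) :=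
      initSeg_mono n (by rw [ha]; omega)
    have hRS := Finset.union_subset (hR.trans hmono) hS'
    refine ⟨S, hS, fun v hv => ?_, Finset.union_subset (hB.trans hmono) hRS⟩
    exact Finset.union_subset (Finset.insert_subset (hRS hv) (hB.trans hmono)) hRS
  · intro t R h
    exact hx t (sq_le_of_univ_subset_initSeg (Finset.union_subset_left h))

/-- A finer estimate: only the fire lit in the previous round can leave the set of revealed vertices
immediately, and it does so at two vertices at most; the older fires are held back by one more
round of propagation. The potential `Φ` measures the number of rounds needed to cover an initial
segment. -/
theorem le_liminalBurningNumber_of_potential {k : ℕ} (hk : 1 ≤ k) (Φ : ℕ → ℝ) (ε : ℝ)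
    (hmono : Monotone Φ) (hε : Φ k + ε ≤ 1) (h0 : Φ 0 = 0) (hε1 : ε ≤ 1)
    (h1 : ∀ m, Φ (m + k + 2) ≤ Φ m + 1)
    (h2 : ∀ m, Φ (grow n m) ≤ Φ m + 1)
    (h3 : ∀ m, Φ (grow n (grow n m) + k + 2) ≤ Φ m + 2) (hn : 1 ≤ n) :
    Φ (n ^ 2) + ε ≤ (liminalBurningNumber (grid n) k : ℝ) := by
  classical
  have : Nonempty (Fin n) := ⟨⟨0, hn⟩⟩
  refine le_liminalBurningNumber (grid n) hk _
    (fun t B R => (t = 0 ∧ B = ∅ ∧ R = ∅) ∨ ∃ m b, ∃ A : Finset (Fin n × Fin n), A.card ≤ 1 ∧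
      B ∪ R ⊆ initSeg n m ∧ B ⊆ initSeg n b ∪ A ∧ Φ m + ε ≤ t ∧ Φ (grow n b + k + 2) + ε ≤ t + 1)
    (by simp) ?_ ?_
  · rintro t B R (⟨rfl, rfl, rfl⟩ | ⟨m, b, A, hA, hm, hb, hΦ, hΦ'⟩)
    · obtain ⟨S, hS, hsub⟩ := exists_isReveal_subset_initSeg k (propagate (grid n) ∅) ∅
      have he : propagate (grid n) ∅ = ∅ := by simp [propagate]
      have hSk : S ⊆ initSeg n k := by simpa using hsub 0 0 (by simp [he])
      have h4 : Φ (grow n 0 + k + 2) + ε ≤ ((0 + 1 : ℕ) : ℝ) + 1 := by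
        have := h1 0
        rw [h0] at this
        simp only [grow, if_true]
        push_cast
        linarith
      have h5 : Φ k + ε ≤ ((0 + 1 : ℕ) : ℝ) := by push_cast; linarith
      refine ⟨S, hS, fun v hv => Or.inr ⟨k, 0, {v}, by simp, ?_, by simp [he], h5, h4⟩,
        Or.inr ⟨k, 0, ∅, by simp, by simpa [he] using hSk, by simp [he], h5, h4⟩⟩
      rw [Finset.empty_union] at hv ⊢
      rw [he]
      exact Finset.union_subset (by simpa using hSk hv) hSk
    · obtain ⟨S, hS, hsub⟩ := exists_isReveal_subset_initSeg k (propagate (grid n) B) R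
      have hB := propagate_subset_grow (Finset.union_subset_left hm)
      set M := max m (grow n b) with hM
      have hcard : ((propagate (grid n) B ∪ R) \ initSeg n M).card ≤ 2 := by
        -- A vertex outside this initial segment is a neighbor of the newest fire.
        have hout : ∀ w ∈ (propagate (grid n) B ∪ R) \ initSeg n M,
            ∃ u ∈ A, idx u < m ∧ (grid n).Adj u w ∧ M ≤ idx w := by
          intro w hw
          rw [Finset.mem_sdiff, Finset.mem_union, mem_initSeg, not_lt] at hw
          obtain ⟨hw1, hw2⟩ := hw
          have hnot : w ∉ B ∪ R := fun h => by
            have := mem_initSeg.1 (hm h)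
            omega
          rcases hw1 with hw1 | hw1
          · rcases mem_propagate.1 hw1 with h | ⟨u, hu, huw⟩
            · exact absurd (Finset.mem_union_left _ h) hnot
            · rcases Finset.mem_union.1 (hb hu) with h | h
              · have := idx_lt_grow_of_adj (mem_initSeg.1 h) huw
                omega
              · exact ⟨u, h, mem_initSeg.1 (hm (Finset.mem_union_left _ hu)), huw, hw2⟩
          · exact absurd (Finset.mem_union_right _ hw1) hnot
        rcases ((propagate (grid n) B ∪ R) \ initSeg n M).eq_empty_or_nonempty with h | ⟨w, hw⟩
        · simp [h]
        · obtain ⟨u, hu, hum, -⟩ := hout w hw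
          refine (Finset.card_le_card ?_).trans
            (card_neighbors_sdiff_initSeg_le (m := M) (u := u) (by omega))
          intro w' hw'
          obtain ⟨u', hu', -, hadj, hle⟩ := hout w' hw'
          rw [Finset.card_le_one.1 hA u' hu' u hu] at hadj
          exact Finset.mem_filter.2 ⟨Finset.mem_univ _, hadj, hle⟩
      have hS' := hsub M 2 hcard
      set m' := max (M + 2 + k) (grow n m) with hm'
      have hB' : propagate (grid n) B ⊆ initSeg n m' :=
        hB.trans (initSeg_mono n (le_max_right _ _))
      have hR' : R ⊆ initSeg n m' :=
        (Finset.union_subset_right hm).trans (initSeg_mono n (by omega))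
      have hRS : R ∪ S ⊆ initSeg n m' :=
        Finset.union_subset hR' (hS'.trans (initSeg_mono n (le_max_left _ _)))
      have hΦm : Φ m' + ε ≤ ((t + 1 : ℕ) : ℝ) := by
        push_cast
        rcases max_choice (M + 2 + k) (grow n m) with h | h
        · rcases max_choice m (grow n b) with g | g
          · have e : m' = m + k + 2 := by omega
            rw [e]
            linarith [h1 m]
          · have e : m' = grow n b + k + 2 := by omega
            rw [e]
            linarith
        · rw [hm', h]
          linarith [h2 m]
      have hΦb : Φ (grow n (grow n m) + k + 2) + ε ≤ ((t + 1 : ℕ) : ℝ) + 1 := by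
        push_cast
        linarith [h3 m]
      refine ⟨S, hS, fun v hv => Or.inr ⟨m', grow n m, {v}, by simp, ?_, ?_, hΦm, hΦb⟩,
        Or.inr ⟨m', grow n m, ∅, by simp, Finset.union_subset hB' hRS, by simpa using hB,
          hΦm, hΦb⟩⟩
      · exact Finset.union_subset (Finset.insert_subset (hRS hv) hB') hRS
      · refine Finset.insert_subset (by simp) (hB.trans Finset.subset_union_left)
  · rintro t R (⟨-, h, -⟩ | ⟨m, b, A, -, hm, -, hΦ, -⟩)
    · exact absurd h Finset.univ_nonempty.ne_empty
    · have := hmono (sq_le_of_univ_subset_initSeg (Finset.union_subset_left hm))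
      linarith

end Game

/-! ### The volume bound -/

section Volume

variable {n : ℕ}

/-- The ball of radius `r` around `c` in the graph distance of the grid. -/
def gridBall (c : Fin n × Fin n) (r : ℕ) : Finset (Fin n × Fin n) :=
  Finset.univ.filter (fun v => |(v.1 : ℤ) - c.1| + |(v.2 : ℤ) - c.2| ≤ r)

theorem mem_gridBall {c v : Fin n × Fin n} {r : ℕ} :
    v ∈ gridBall c r ↔
      ((v.1 : ℤ) - c.1) + (v.2 - c.2) ≤ r ∧ ((v.1 : ℤ) - c.1) - (v.2 - c.2) ≤ r ∧
      -((v.1 : ℤ) - c.1) + (v.2 - c.2) ≤ r ∧ -((v.1 : ℤ) - c.1) - (v.2 - c.2) ≤ r := by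
  simp only [gridBall, Finset.mem_filter, Finset.mem_univ, true_and]
  rcases abs_cases ((v.1 : ℤ) - c.1) with ⟨h1, h1'⟩ | ⟨h1, h1'⟩ <;>
  rcases abs_cases ((v.2 : ℤ) - c.2) with ⟨h2, h2'⟩ | ⟨h2, h2'⟩ <;>
    (rw [h1, h2]; omega)

theorem mem_gridBall_succ_of_adj {c u v : Fin n × Fin n} {r : ℕ} (hu : u ∈ gridBall c r)
    (h : (grid n).Adj u v) : v ∈ gridBall c (r + 1) := by
  rw [mem_gridBall] at hu ⊢
  rw [grid_adj] at h
  push_cast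
  rcases h with ⟨h | h, h'⟩ | ⟨h | h, h'⟩ <;>
    (have := congrArg Fin.val h'; omega)

/-- In the coordinates `x + y + r` and `x - y + r`, whose parities agree, a ball consists of two square
arrays of side lengths `r + 1` and `r`. -/
theorem card_gridBall_le (c : Fin n × Fin n) (r : ℕ) :
    (gridBall c r).card ≤ (r + 1) ^ 2 + r ^ 2 := by
  let f : Fin n × Fin n → (ℤ × ℤ) ⊕ (ℤ × ℤ) := fun v =>
    let a := ((v.1 : ℤ) - c.1) + ((v.2 : ℤ) - c.2) + r
    let b := ((v.1 : ℤ) - c.1) - ((v.2 : ℤ) - c.2) + r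
    if a % 2 = 0 then Sum.inl (a / 2, b / 2) else Sum.inr (a / 2, b / 2)
  have hmaps : ∀ v ∈ gridBall c r, f v ∈
      ((Finset.Ico (0 : ℤ) (r + 1) ×ˢ Finset.Ico (0 : ℤ) (r + 1)).disjSum
        (Finset.Ico (0 : ℤ) r ×ˢ Finset.Ico (0 : ℤ) r)) := by
    intro v hv
    rw [mem_gridBall] at hv
    simp only [f]
    split_ifs with h
    · simp only [Finset.inl_mem_disjSum, Finset.mem_product, Finset.mem_Ico]
      omega
    · simp only [Finset.inr_mem_disjSum, Finset.mem_product, Finset.mem_Ico]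
      omega
  have hinj : Set.InjOn f (gridBall c r) := by
    intro v _ w _ h
    simp only [f] at h
    split_ifs at h with h1 h2 h2
    · simp only [Sum.inl.injEq, Prod.mk.injEq] at h
      ext <;> omega
    · simp only [Sum.inr.injEq, Prod.mk.injEq] at h
      ext <;> omega
  refine (Finset.card_le_card_of_injOn f hmaps hinj).trans ?_
  rw [Finset.card_disjSum, Finset.card_product, Finset.card_product]
  simp [Int.card_Ico, sq]

/-- After `t` rounds the burned vertices are covered by balls of radii `0, 1, …, t - 1`, so a game of
`t` rounds burns at most `∑ i < t, (2 * i ^ 2 + 2 * i + 1)` vertices. -/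
theorem rpow_le_liminalBurningNumber {k : ℕ} (hk : 1 ≤ k) (hn : 1 ≤ n) :
    (3 / 2 : ℝ) ^ (1 / 3 : ℝ) * (n : ℝ) ^ (2 / 3 : ℝ) - 1
      ≤ (liminalBurningNumber (grid n) k : ℝ) := by
  classical
  refine le_liminalBurningNumber (grid n) hk _
    (fun t B _ => ∃ c : ℕ → Fin n × Fin n, B ⊆ (Finset.range t).biUnion fun i => gridBall (c i) i)
    ⟨fun _ => ⟨⟨0, hn⟩, ⟨0, hn⟩⟩, by simp⟩ ?_ ?_
  · rintro t B R ⟨c, hc⟩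
    obtain ⟨S, hS, -⟩ := exists_isReveal_subset_initSeg k (propagate (grid n) B) R
    have hprop : ∀ v, propagate (grid n) B ⊆
        (Finset.range (t + 1)).biUnion fun i => gridBall (if i = 0 then v else c (i - 1)) i := by
      intro v w hw
      simp only [Finset.mem_biUnion, Finset.mem_range]
      have hc' : ∀ u ∈ B, ∃ i < t, u ∈ gridBall (c i) i := by
        intro u hu
        simpa using hc hu
      rcases mem_propagate.1 hw with h | ⟨u, hu, huw⟩
      · obtain ⟨i, hi, h⟩ := hc' w h
        refine ⟨i + 1, by omega, ?_⟩
        rw [if_neg (Nat.succ_ne_zero i), Nat.add_sub_cancel]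
        rw [mem_gridBall] at h ⊢
        push_cast
        omega
      · obtain ⟨i, hi, h⟩ := hc' u hu
        refine ⟨i + 1, by omega, ?_⟩
        rw [if_neg (Nat.succ_ne_zero i), Nat.add_sub_cancel]
        exact mem_gridBall_succ_of_adj h huw
    refine ⟨S, hS, fun v _ => ⟨fun i => if i = 0 then v else c (i - 1), Finset.insert_subset ?_ (hprop v)⟩,
      ⟨fun i => if i = 0 then c 0 else c (i - 1), hprop _⟩⟩
    simp only [Finset.mem_biUnion, Finset.mem_range]
    exact ⟨0, by omega, by simp [mem_gridBall]⟩
  · rintro t - ⟨c, hc⟩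
    have h1 : n ^ 2 ≤ ∑ i ∈ Finset.range t, ((i + 1) ^ 2 + i ^ 2) := by
      calc n ^ 2 = (Finset.univ : Finset (Fin n × Fin n)).card := by simp [sq]
        _ ≤ _ := Finset.card_le_card hc
        _ ≤ _ := Finset.card_biUnion_le
        _ ≤ _ := Finset.sum_le_sum fun i _ => card_gridBall_le (c i) i
    have h2 : ∀ s : ℕ, 3 * ∑ i ∈ Finset.range s, ((i + 1) ^ 2 + i ^ 2) ≤ 2 * (s + 1) ^ 3 := by
      intro s
      induction s with
      | zero => simp
      | succ s ih =>
        rw [Finset.sum_range_succ]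
        have e : 2 * (s + 1 + 1) ^ 3 = 2 * (s + 1) ^ 3 + (6 * s ^ 2 + 18 * s + 14) := by ring
        linarith
    have h3 : (3 / 2 : ℝ) * (n : ℝ) ^ 2 ≤ ((t : ℝ) + 1) ^ 3 := by
      have h4 : 3 * n ^ 2 ≤ 2 * (t + 1) ^ 3 := (Nat.mul_le_mul_left 3 h1).trans (h2 t)
      have h5 : (3 * (n : ℝ) ^ 2) ≤ 2 * ((t : ℝ) + 1) ^ 3 := by exact_mod_cast h4
      linarith
    have h4 : (3 / 2 : ℝ) ^ (1 / 3 : ℝ) * (n : ℝ) ^ (2 / 3 : ℝ) =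
        ((3 / 2 : ℝ) * (n : ℝ) ^ 2) ^ (1 / 3 : ℝ) := by
      rw [Real.mul_rpow (by norm_num) (by positivity), ← Real.rpow_natCast (n : ℝ) 2,
        ← Real.rpow_mul (by positivity)]
      norm_num
    have h5 : (((t : ℝ) + 1) ^ 3) ^ (1 / 3 : ℝ) = (t : ℝ) + 1 := by
      rw [← Real.rpow_natCast ((t : ℝ) + 1) 3, ← Real.rpow_mul (by positivity)]
      norm_num
    have h6 := Real.rpow_le_rpow (by positivity) h3 (by norm_num : (0 : ℝ) ≤ 1 / 3)
    rw [h5] at h6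
    rw [h4]
    linarith

end Volume

/-! ### Weights on the diagonals -/

section Weights

/-- The total weight of the first `m` positions, if each vertex of diagonal `s` has weight `w s`. -/
noncomputable def potential (n : ℕ) (w : ℕ → ℝ) (m : ℕ) : ℝ :=
  ∑ p ∈ Finset.range m, if p < n ^ 2 then w (diagOf n p) else 0

theorem potential_mono (n : ℕ) {w : ℕ → ℝ} (hw : ∀ s, 0 ≤ w s) : Monotone (potential n w) := by
  refine monotone_nat_of_le_succ fun m => ?_
  rw [potential, potential, Finset.sum_range_succ]
  split_ifs
  · linarith [hw (diagOf n m)]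
  · linarith

theorem potential_add_le (n : ℕ) {w : ℕ → ℝ} {m d : ℕ} {c : ℝ} (hc : 0 ≤ c)
    (h : ∀ p, m ≤ p → p < m + d → p < n ^ 2 → w (diagOf n p) ≤ c) :
    potential n w (m + d) ≤ potential n w m + d * c := by
  unfold potential
  rw [Finset.sum_range_add]
  have : ∑ x ∈ Finset.range d, (if m + x < n ^ 2 then w (diagOf n (m + x)) else 0) ≤
      ∑ _x ∈ Finset.range d, c := by
    refine Finset.sum_le_sum fun x hx => ?_
    have hx' := Finset.mem_range.1 hx
    split_ifs with h1
    · exact h _ (Nat.le_add_right _ _) (by omega) h1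
    · exact hc
  rw [Finset.sum_const, Finset.card_range, nsmul_eq_mul] at this
  linarith

theorem potential_add_of_sq_le {n m : ℕ} (w : ℕ → ℝ) (hm : n ^ 2 ≤ m) (d : ℕ) :
    potential n w (m + d) = potential n w m := by
  unfold potential
  rw [Finset.sum_range_add, Finset.sum_eq_zero (s := Finset.range d), add_zero]
  intro x _
  rw [if_neg (by omega)]

theorem potential_sq {n : ℕ} (hn : 1 ≤ n) (w : ℕ → ℝ) :
    potential n w (n ^ 2) =
      ∑ j ∈ Finset.range n, (((j : ℝ) + 1) * w j + (j : ℝ) * w (2 * n - 1 - j)) := by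
  have h1 : ∀ S, S ≤ 2 * n - 1 → potential n w (diagStart n S) =
      ∑ s ∈ Finset.range S, (diagLen n s : ℝ) * w s := by
    intro S hS
    induction S with
    | zero => simp [potential, diagStart]
    | succ S ih =>
      rw [Finset.sum_range_succ, ← ih (by omega), diagStart_succ]
      unfold potential
      rw [Finset.sum_range_add]
      congr 1
      have hle : diagStart n (S + 1) ≤ n ^ 2 := by
        rw [← diagStart_last hn]
        exact diagStart_mono n hS
      rw [diagStart_succ] at hle
      rw [Finset.sum_congr rfl (g := fun _ => w S), Finset.sum_const, Finset.card_range,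
        nsmul_eq_mul]
      intro x hx
      have hx' := Finset.mem_range.1 hx
      rw [if_pos (by omega), diagOf_diagStart_add (by omega) hx']
  rw [← diagStart_last hn, h1 _ le_rfl, Finset.sum_add_distrib]
  have e : 2 * n - 1 = n + (n - 1) := by omega
  rw [e, Finset.sum_range_add]
  congr 1
  · refine Finset.sum_congr rfl fun s hs => ?_
    have hs' := Finset.mem_range.1 hs
    have : diagLen n s = s + 1 := by unfold diagLen; omega
    rw [this]
    push_cast
    ring
  · obtain ⟨d, rfl⟩ : ∃ d, n = d + 1 := ⟨n - 1, by omega⟩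
    rw [Finset.sum_range_succ', Nat.add_sub_cancel, ← Finset.sum_range_reflect]
    simp only [Nat.cast_zero, zero_mul, add_zero]
    refine Finset.sum_congr rfl fun s hs => ?_
    have hs' := Finset.mem_range.1 hs
    have h2 : diagLen (d + 1) (d + 1 + (d - 1 - s)) = s + 1 := by unfold diagLen; omega
    have h3 : d + 1 + (d - 1 - s) = d + 1 + d - (s + 1) := by omega
    rw [h2, h3]

/-- For a fire that spreads at every round through everything revealed, the vertices of the diagonal
with `j` vertices get weight `1 / (j + k + 1)` in the growing half, and
`1 / (max j k + k + 2)` in the shrinking half. -/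
theorem sum_le_liminalBurningNumber_of_small {k n : ℕ} (hk : 1 ≤ k) (hn : 1 ≤ n) :
    ∑ j ∈ Finset.range n, (((j : ℝ) + 1) * (1 / ((j : ℝ) + 2 + k)) +
        (j : ℝ) * (1 / ((max j k : ℕ) + k + 2 : ℝ)))
      ≤ (liminalBurningNumber (grid n) k : ℝ) := by
  let den : ℕ → ℕ := fun s => if s < n then s + 2 + k else max (2 * n - 1 - s) k + k + 2
  let w : ℕ → ℝ := fun s => 1 / (den s : ℝ)
  have hw : ∀ s, 0 ≤ w s := fun s => by positivity
  have hstep : ∀ m, potential n w (grow n m + k) ≤ potential n w m + 1 := by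
    intro m
    have main : ∀ d : ℕ, 0 < d → (∀ p, m ≤ p → p < m + d → p < n ^ 2 → d ≤ den (diagOf n p)) →
        potential n w (m + d) ≤ potential n w m + 1 := by
      intro d hd h
      have h1 := potential_add_le n (w := w) (m := m) (d := d) (c := 1 / (d : ℝ)) (by positivity)
        (fun p hp1 hp2 hp3 => one_div_le_one_div_of_le (by exact_mod_cast hd)
          (by exact_mod_cast h p hp1 hp2 hp3))
      rwa [mul_one_div_cancel (by positivity)] at h1
    unfold grow
    -- It remains to see that all weights on the positions covered in this round are small enough.
    split_ifs with hm
    · rw [hm] at main ⊢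
      rw [zero_add]
      have := main k hk (fun p _ _ _ => by simp only [den]; split_ifs <;> omega)
      rwa [zero_add] at this
    · rw [add_assoc]
      refine main _ (by omega) fun p hp1 hp2 hp3 => ?_
      set s := diagOf n (m - 1) with hs
      have h1 : s ≤ diagOf n p := diagOf_mono n (by omega)
      have h2 := diagOf_le n p
      have h3 : m - 1 < diagStart n (s + 1) := lt_diagStart_diagOf_succ (by omega)
      have h4 : diagStart n (s + 1 + 1 + 1) =
          diagStart n (s + 1) + diagLen n (s + 1) + diagLen n (s + 1 + 1) := by
        rw [diagStart_succ n (s + 1 + 1), diagStart_succ n (s + 1)]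
      have h5 : p < diagStart n (s + 1 + 1 + 1) → diagOf n p < s + 1 + 1 + 1 :=
        diagOf_lt_of_lt_diagStart
      simp only [den]
      unfold reach diagLen at *
      rcases Nat.lt_or_ge p (diagStart n (s + 1 + 1 + 1)) with h6 | h6
      · have := h5 h6
        split_ifs <;> omega
      · split_ifs <;> omega
  let a : ℕ → ℕ := fun t => Nat.rec 0 (fun _ b => grow n b + k) t
  have ha : ∀ t, potential n w (a t) ≤ t := by
    intro t
    induction t with
    | zero => simp [a, potential]
    | succ t ih =>
      have := hstep (a t)
      push_cast
      exact this.trans (by linarith)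
  have hsum : potential n w (n ^ 2) = ∑ j ∈ Finset.range n,
      (((j : ℝ) + 1) * (1 / ((j : ℝ) + 2 + k)) + (j : ℝ) * (1 / ((max j k : ℕ) + k + 2 : ℝ))) := by
    rw [potential_sq hn]
    refine Finset.sum_congr rfl fun j hj => ?_
    have hj' := Finset.mem_range.1 hj
    have e1 : den j = j + 2 + k := if_pos hj'
    rw [show w j = 1 / (den j : ℝ) from rfl, e1]
    rcases Nat.eq_zero_or_pos j with rfl | hpos
    · push_cast
      ring
    · have e2 : den (2 * n - 1 - j) = max j k + k + 2 := by
        simp only [den]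
        rw [if_neg (by omega)]
        congr 3
        omega
      rw [show w (2 * n - 1 - j) = 1 / (den (2 * n - 1 - j) : ℝ) from rfl, e2]
      push_cast
      rfl
  rw [← hsum]
  exact le_liminalBurningNumber_of_grow hk _ a (fun _ => rfl)
    (fun t ht => (potential_mono n hw ht).trans (ha t))

theorem diagStart_add_ge {n s : ℕ} (r : ℕ) :
    diagStart n (s + 1) + r * diagLen n s ≤
      diagStart n (s + 1 + r) + ∑ i ∈ Finset.range r, (i + 1) := by
  induction r with
  | zero => simp
  | succ r ih =>
    rw [← add_assoc, diagStart_succ n (s + 1 + r), Finset.sum_range_succ, Nat.succ_mul]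
    have : diagLen n s ≤ diagLen n (s + 1 + r) + (r + 1) := by unfold diagLen; omega
    omega

/-- For large `k`, a vertex of a diagonal with `j` vertices gets weight
`1 / max (k + 2) (j + k / 2 + 21 / 2)`: two successive rounds add at most `2 * (k + 2)` vertices, or
else at most `2 * j + k + 5` vertices, which lie within the next eight diagonals. -/
theorem sum_le_liminalBurningNumber_of_large {k n : ℕ} (hk : 21 ≤ k) (hn : 1 ≤ n) :
    ∑ j ∈ Finset.range n,
        (((j : ℝ) + 1) * (2 / ((max (2 * k + 4) (2 * (j + 1) + k + 21) : ℕ) : ℝ)) +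
          (j : ℝ) * (2 / ((max (2 * k + 4) (2 * j + k + 21) : ℕ) : ℝ))) + 2 / ((k : ℝ) + 2)
      ≤ (liminalBurningNumber (grid n) k : ℝ) := by
  let den : ℕ → ℕ := fun s => max (2 * k + 4) (2 * diagLen n s + k + 21)
  let w : ℕ → ℝ := fun s => 2 / (den s : ℝ)
  have hw : ∀ s, 0 ≤ w s := fun s => by positivity
  have hmono := potential_mono n hw
  have hcap : ∀ m d, potential n w (m + d) ≤ potential n w m + d * (1 / ((k : ℝ) + 2)) := by
    intro m d
    refine potential_add_le n (by positivity) fun p _ _ _ => ?_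
    have h1 : (2 * k + 4 : ℕ) ≤ den (diagOf n p) := le_max_left _ _
    have h2 : (2 * (k : ℝ) + 4) ≤ den (diagOf n p) := by exact_mod_cast h1
    rw [div_le_div_iff₀ (by linarith [Nat.cast_nonneg (α := ℝ) k]) (by positivity)]
    linarith
  have hspan : ∀ m, m ≠ 0 → m ≤ n ^ 2 → ∀ d, d ≤ 2 * diagLen n (diagOf n (m - 1)) + k + 5 →
      potential n w (m + d) ≤ potential n w m +
        d * (2 / ((2 * diagLen n (diagOf n (m - 1)) + k + 5 : ℕ) : ℝ)) := by
    intro m hm hm2 d hd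
    refine potential_add_le n (by positivity) fun p hp1 hp2 _ => ?_
    set s := diagOf n (m - 1) with hs
    have h1 : s ≤ diagOf n p := diagOf_mono n (by omega)
    have h3 : m - 1 < diagStart n (s + 1) := lt_diagStart_diagOf_succ (by omega)
    have h4 : 2 * diagLen n s + k + 5 ≤ den (diagOf n p) := by
      -- If not, then `2 * diagLen n s ≥ k`, so that the next eight diagonals contain all these
      -- positions, and none of these diagonals is shorter than diagonal `s` by more than eight.
      by_contra hcon
      rw [not_le] at hcon
      obtain ⟨hc1, hc2⟩ := max_lt_iff.1 hcon
      have h5 := diagStart_add_ge (n := n) (s := s) 8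
      have h6 : ∑ i ∈ Finset.range 8, (i + 1) = 36 := by decide
      rw [h6] at h5
      have h7 : diagOf n p < s + 1 + 8 := diagOf_lt_of_lt_diagStart (by omega)
      have h8 : diagLen n s ≤ diagLen n (diagOf n p) + 8 := by unfold diagLen; omega
      omega
    have h9 : ((2 * diagLen n s + k + 5 : ℕ) : ℝ) ≤ den (diagOf n p) := by exact_mod_cast h4
    exact div_le_div_of_nonneg_left (by norm_num) (by positivity) h9
  have h0 : potential n w 0 = 0 := by simp [potential]
  have h1 : ∀ m, potential n w (m + k + 2) ≤ potential n w m + 1 := by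
    intro m
    have := hcap m (k + 2)
    push_cast at this
    rwa [mul_one_div_cancel (by positivity), ← add_assoc] at this
  have hk2 : potential n w k + 2 / ((k : ℝ) + 2) ≤ 1 := by
    have h2 := hcap 0 k
    rw [zero_add, h0, zero_add] at h2
    have h3 : (k : ℝ) * (1 / ((k : ℝ) + 2)) + 2 / ((k : ℝ) + 2) = 1 := by
      field_simp
    linarith
  have h2 : ∀ m, potential n w (grow n m) ≤ potential n w m + 1 := by
    intro m
    unfold grow
    split_ifs with hm
    · rw [hm]
      linarith
    · rcases Nat.lt_or_ge (n ^ 2) m with hlt | hge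
      · rw [potential_add_of_sq_le w hlt.le]
        linarith
      · have hr : reach n (diagOf n (m - 1)) ≤ diagLen n (diagOf n (m - 1)) + 1 := by
          unfold reach diagLen
          omega
        refine (hspan m hm hge _ (by omega)).trans ?_
        have hr' : (reach n (diagOf n (m - 1)) : ℝ) ≤ diagLen n (diagOf n (m - 1)) + 1 := by
          exact_mod_cast hr
        have : (reach n (diagOf n (m - 1)) : ℝ) *
            (2 / ((2 * diagLen n (diagOf n (m - 1)) + k + 5 : ℕ) : ℝ)) ≤ 1 := by
          rw [mul_div_assoc', div_le_one (by positivity)]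
          push_cast
          linarith [Nat.cast_nonneg (α := ℝ) k]
        linarith
  have h3 : ∀ m, potential n w (grow n (grow n m) + k + 2) ≤ potential n w m + 2 := by
    intro m
    rcases Nat.eq_zero_or_pos m with rfl | hpos
    · have := h1 0
      simp only [grow, if_true]
      linarith
    · have hm : m ≠ 0 := by omega
      have e1 : grow n m = m + reach n (diagOf n (m - 1)) := if_neg hm
      have hg := le_grow n m
      have e2 : grow n (grow n m) = grow n m + reach n (diagOf n (grow n m - 1)) :=
        if_neg (by omega)
      rcases Nat.lt_or_ge (n ^ 2) m with hlt | hge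
      · rw [e2, e1, add_assoc, add_assoc, add_assoc, potential_add_of_sq_le w hlt.le]
        linarith
      · set s := diagOf n (m - 1) with hs
        have hb := diagOf_le n (m - 1)
        have h4 : m - 1 < diagStart n (s + 1) := lt_diagStart_diagOf_succ (by omega)
        have h5 : s ≤ diagOf n (grow n m - 1) := diagOf_mono n (by omega)
        have h6 : reach n s + reach n (diagOf n (grow n m - 1)) ≤ 2 * diagLen n s + 3 := by
          rcases Nat.lt_or_ge (s + 1) n with h7 | h7
          · have h8 : diagOf n (grow n m - 1) < s + 1 + 1 := by
              apply diagOf_lt_of_lt_diagStart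
              rw [diagStart_succ n (s + 1), e1]
              unfold reach diagLen
              omega
            unfold reach diagLen
            omega
          · unfold reach diagLen
            omega
        have h9 : grow n (grow n m) + k + 2 ≤ m + (2 * diagLen n s + k + 5) := by omega
        refine (hmono h9).trans ((hspan m hm hge _ le_rfl).trans ?_)
        rw [← hs, mul_div_cancel₀ _ (by positivity)]
  have hsum : potential n w (n ^ 2) = ∑ j ∈ Finset.range n,
      (((j : ℝ) + 1) * (2 / ((max (2 * k + 4) (2 * (j + 1) + k + 21) : ℕ) : ℝ)) +
        (j : ℝ) * (2 / ((max (2 * k + 4) (2 * j + k + 21) : ℕ) : ℝ))) := by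
    rw [potential_sq hn]
    refine Finset.sum_congr rfl fun j hj => ?_
    have hj' := Finset.mem_range.1 hj
    have e1 : diagLen n j = j + 1 := by unfold diagLen; omega
    have e2 : diagLen n (2 * n - 1 - j) = j := by unfold diagLen; omega
    simp only [w, den, e1, e2]
  rw [← hsum]
  refine le_liminalBurningNumber_of_potential (by omega) _ _ hmono hk2 h0 ?_ h1 h2 h3 hn
  rw [div_le_one (by positivity)]
  linarith [Nat.cast_nonneg (α := ℝ) k]

end Weights

/-! ### One revealed vertex per round -/

section OneVertex

theorem grow_of_add_eq_diagStart {n m s g : ℕ} (hs : s ≤ 2 * n - 2) (hg : g < diagLen n s)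
    (h : m + g = diagStart n (s + 1)) : grow n m = m + reach n s := by
  rw [diagStart_succ] at h
  have e : m - 1 = diagStart n s + (diagLen n s - 1 - g) := by omega
  unfold grow
  rw [if_neg (by omega), e, diagOf_diagStart_add hs (by omega)]

variable {n : ℕ} {a : ℕ → ℕ}

theorem strictMono_of_grow (ha : ∀ t, a (t + 1) = grow n (a t) + 1) : StrictMono a :=
  strictMono_nat_of_lt_succ fun t => by
    have := le_grow n (a t)
    rw [ha]
    omega

/-- In the shrinking half, let the last diagonal reached have `l` vertices, `g` of which are missing.
As long as no diagonal is completed, `2 * l - g` is constant, and it is halved, rounding down,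
whenever one is completed, by which the fire gains a round. It is always at least
`2`, so that `i` bounds the number of rounds gained. -/
theorem rounds_of_shrinking (ha : ∀ t, a (t + 1) = grow n (a t) + 1) {t' : ℕ}
    (ht' : n ^ 2 ≤ a t') (l : ℕ) :
    ∀ g t i : ℕ, 1 ≤ l → l ≤ n → g < l → a t + g = diagStart n (2 * n - 1 - l + 1) →
      2 * l - g < 2 ^ (i + 2) → t + l ≤ t' + 1 + i := by
  induction l using Nat.strong_induction_on with
  | _ l ih =>
    intro g t i hl hln hg hat hc
    have hmono := strictMono_of_grow ha
    have hle : diagStart n (2 * n - 1 - l + 1) ≤ n ^ 2 := by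
      rw [← diagStart_last (hl.trans hln)]
      exact diagStart_mono n (by omega)
    have htt' : t ≤ t' := hmono.le_iff_le.1 (by omega)
    have hlen : diagLen n (2 * n - 1 - l) = l := by unfold diagLen; omega
    have hnext : a (t + 1) = a t + l + 1 := by
      rw [ha, grow_of_add_eq_diagStart (by omega) (by rwa [hlen]) hat]
      have : reach n (2 * n - 1 - l) = l := by unfold reach; omega
      omega
    rcases Nat.lt_or_ge l 2 with h1 | h2
    · omega
    · have e1 : 2 * n - 1 - (l - 1) = 2 * n - 1 - l + 1 := by omega
      have e2 : 2 * n - 1 - (l - 2) = 2 * n - 1 - l + 1 + 1 := by omega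
      have d1 : diagStart n (2 * n - 1 - (l - 1) + 1) = diagStart n (2 * n - 1 - l + 1) + (l - 1) := by
        rw [diagStart_succ, e1]
        unfold diagLen
        omega
      have hlt : t + 1 ≤ t' := by
        have h3 : diagStart n (2 * n - 1 - (l - 1) + 1) ≤ n ^ 2 := by
          rw [← diagStart_last (hl.trans hln)]
          exact diagStart_mono n (by omega)
        exact hmono.lt_iff_lt.1 (by omega)
      rcases Nat.lt_or_ge g 2 with h3 | h3
      · rcases Nat.lt_or_ge l (4 - g) with h4 | h4
        · -- The next round ends the game.
          rcases Nat.eq_zero_or_pos i with rfl | hi <;> omega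
        · obtain ⟨i, rfl⟩ : ∃ i', i = i' + 1 := by
            refine ⟨i - 1, ?_⟩
            rcases Nat.eq_zero_or_pos i with rfl | hi <;> omega
          have d2 : diagStart n (2 * n - 1 - (l - 2) + 1) =
              diagStart n (2 * n - 1 - (l - 1) + 1) + (l - 2) := by
            rw [diagStart_succ, e2, e1]
            unfold diagLen
            omega
          have hpow : 2 ^ (i + 1 + 2) = 2 * 2 ^ (i + 2) := by ring
          have := ih (l - 2) (by omega) (l + g - 4) (t + 1) i (by omega) (by omega) (by omega)
            (by omega) (by omega)
          omega
      · have := ih (l - 1) (by omega) (g - 2) (t + 1) i (by omega) (by omega) (by omega)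
          (by omega) (by omega)
        omega

/-- In the growing half, let diagonal `s` be the last one reached, let `g` of its vertices be missing, and
let `e` be the number of rounds gained so far. As long as no diagonal is completed, `s + g + 4`
is constant, and it doubles whenever one is completed. -/
theorem rounds_of_growing (ha : ∀ t, a (t + 1) = grow n (a t) + 1) {t' : ℕ}
    (ht' : n ^ 2 ≤ a t') (d : ℕ) :
    ∀ s g t e : ℕ, s + 1 + d = n → g ≤ s → a t + g = diagStart n (s + 1) → t + e = s + 1 →
      s + g + 4 = 2 ^ (e + 2) → 2 * n ≤ t' + 2 * Nat.log 2 (n + 3) := by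
  induction d using Nat.strong_induction_on with
  | _ d ih =>
    intro s g t e hd hg hat hte hc
    have hpow : 2 ^ (e + 1 + 2) = 2 * 2 ^ (e + 2) := by ring
    have hpow' : 2 ^ (e + 2) = 2 * 2 ^ (e + 1) := by ring
    rcases Nat.eq_zero_or_pos d with rfl | hpos
    · have h1 := rounds_of_shrinking ha ht' n g t (e + 1) (by omega) le_rfl (by omega)
        (by rw [hat]; congr 1; omega) (by omega)
      have h2 : e + 1 ≤ Nat.log 2 (n + 3) := Nat.le_log_of_pow_le (by norm_num) (by omega)
      omega
    · have hnext : a (t + 1) = a t + s + 3 := by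
        have hlen : g < diagLen n s := by unfold diagLen; omega
        rw [ha, grow_of_add_eq_diagStart (by omega) hlen hat]
        have : reach n s = s + 2 := by unfold reach; omega
        omega
      have d1 : diagStart n (s + 1 + 1) = diagStart n (s + 1) + (s + 2) := by
        rw [diagStart_succ n (s + 1)]
        unfold diagLen
        omega
      rcases Nat.eq_zero_or_pos g with rfl | hgpos
      · rcases Nat.lt_or_ge d 2 with h2 | h2
        · have d2 : diagStart n (2 * n - 1 - (n - 1) + 1) = diagStart n (s + 1 + 1) + (n - 1) := by
            have e1 : 2 * n - 1 - (n - 1) = s + 1 + 1 := by omega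
            rw [e1, diagStart_succ n (s + 1 + 1)]
            unfold diagLen
            omega
          have h3 := rounds_of_shrinking ha ht' (n - 1) (n - 2) (t + 1) e (by omega) (by omega)
            (by omega) (by omega) (by omega)
          have h4 : e + 2 ≤ Nat.log 2 (n + 3) := Nat.le_log_of_pow_le (by norm_num) (by omega)
          omega
        · have d2 : diagStart n (s + 2 + 1) = diagStart n (s + 1 + 1) + (s + 3) := by
            rw [diagStart_succ n (s + 2), show s + 1 + 1 = s + 2 from rfl]
            unfold diagLen
            omega
          exact ih (d - 2) (by omega) (s + 2) (s + 2) (t + 1) (e + 1) (by omega) le_rfl (by omega)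
            (by omega) (by omega)
      · exact ih (d - 1) (by omega) (s + 1) (g - 1) (t + 1) e (by omega) (by omega) (by omega)
          (by omega) (by omega)

theorem two_mul_sub_log_le_liminalBurningNumber (hn : 1 ≤ n) :
    2 * (n : ℝ) - 2 * (⌊Real.logb 2 ((n : ℝ) + 3)⌋ : ℝ)
      ≤ (liminalBurningNumber (grid n) 1 : ℝ) := by
  have hfloor : ⌊Real.logb 2 ((n : ℝ) + 3)⌋ = (Nat.log 2 (n + 3) : ℤ) := by
    have h1 := Real.floor_logb_natCast (b := 2) (r := ((n + 3 : ℕ) : ℝ)) (by positivity)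
    rw [Int.log_natCast] at h1
    exact_mod_cast h1
  rw [hfloor]
  refine le_liminalBurningNumber_of_grow le_rfl _ (fun t => Nat.rec 0 (fun _ b => grow n b + 1) t)
    (fun _ => rfl) fun t ht => ?_
  have h1 := rounds_of_growing (n := n) (a := fun t => Nat.rec 0 (fun _ b => grow n b + 1) t)
    (fun _ => rfl) ht (n - 1) 0 0 1 0 (by omega) le_rfl
    (by simp [grow, diagStart, diagLen]; omega) rfl rfl
  have h2 : (2 * n : ℝ) ≤ t + 2 * (Nat.log 2 (n + 3) : ℕ) := by exact_mod_cast h1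
  push_cast
  linarith

end OneVertex

/-! ### Comparison with the logarithmic bound -/

section Comparison

/-- The logarithmic lower bound for the intermediate range of `k`, for real arguments. -/
noncomputable def logBound (k n : ℝ) : ℝ :=
  2 * n - 3 * k / 4 - 7 - (2 * k + 3) * Real.log ((2 * n + 2 * k + 3) / (3 * k + 7))

theorem logBound_add_one_le {k n : ℝ} (hk : 0 ≤ k) (hn : 0 ≤ n) :
    logBound k (n + 1) ≤ logBound k n + (2 * n + 1) / (n + k + 2) := by
  have h1 := Real.le_log_one_add_of_nonneg (x := 2 / (2 * n + 2 * k + 3)) (by positivity)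
  have h2 : (1 : ℝ) + 2 / (2 * n + 2 * k + 3) =
      ((2 * (n + 1) + 2 * k + 3) / (3 * k + 7)) / ((2 * n + 2 * k + 3) / (3 * k + 7)) := by
    field_simp
    ring
  rw [h2, Real.log_div (by positivity) (by positivity)] at h1
  have h3 : 2 * (2 / (2 * n + 2 * k + 3)) / (2 / (2 * n + 2 * k + 3) + 2) =
      1 / (n + k + 2) := by
    field_simp
    ring
  rw [h3] at h1
  have h4 : (2 * n + 1) / (n + k + 2) = 2 - (2 * k + 3) * (1 / (n + k + 2)) := by
    field_simp
    ring
  unfold logBound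
  rw [h4]
  nlinarith [mul_le_mul_of_nonneg_left h1 (by positivity : (0 : ℝ) ≤ 2 * k + 3)]

/-- The trapezoidal upper bound for `log b - log a = ∫ x in a..b, 1 / x`. -/
theorem log_div_le_trapezoid {a b : ℝ} (ha : 0 < a) (hab : a ≤ b) :
    Real.log (b / a) ≤ (b ^ 2 - a ^ 2) / (2 * a * b) := by
  have hb : 0 < b := ha.trans_le hab
  have h1 := Real.self_le_sinh_iff.2 (Real.log_nonneg ((one_le_div ha).2 hab))
  rw [Real.sinh_log (by positivity)] at h1
  refine h1.trans (le_of_eq ?_)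
  field_simp

theorem logBound_le_of_trapezoid {k n x : ℝ} (hk : 0 ≤ k) (hn : 0 ≤ n) (h : 2 * n ≤ k + 4)
    (hx : 2 * n - 3 * k / 4 - 7 + (2 * k + 3) * (((3 * k + 7) ^ 2 - (2 * n + 2 * k + 3) ^ 2) /
      (2 * (2 * n + 2 * k + 3) * (3 * k + 7))) ≤ x) : logBound k n ≤ x := by
  have h1 := log_div_le_trapezoid (a := 2 * n + 2 * k + 3) (b := 3 * k + 7) (by positivity)
    (by linarith)
  have h2 : Real.log ((2 * n + 2 * k + 3) / (3 * k + 7)) =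
      -Real.log ((3 * k + 7) / (2 * n + 2 * k + 3)) := by
    rw [← Real.log_inv, inv_div]
  unfold logBound
  rw [h2]
  nlinarith [mul_le_mul_of_nonneg_left h1 (by positivity : (0 : ℝ) ≤ 2 * k + 3)]

/-- Below `n = k` the increments of the sum can fall short of those of the bound, by at most
`1 / 11`; the last term of the estimate keeps a reserve for the losses still to come. -/
theorem logBound_le_sum_of_small {k : ℕ} (hk2 : 2 ≤ k) (hk : k ≤ 20) (n : ℕ) :
    logBound k n ≤ ∑ j ∈ Finset.range n, (((j : ℝ) + 1) * (1 / ((j : ℝ) + 2 + k)) +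
      (j : ℝ) * (1 / ((max j k : ℕ) + k + 2 : ℝ))) - ((k - n : ℕ) : ℝ) / 11 := by
  have hk2' : (2 : ℝ) ≤ k := by exact_mod_cast hk2
  have hk' : (k : ℝ) ≤ 20 := by exact_mod_cast hk
  induction n with
  | zero =>
    refine logBound_le_of_trapezoid (by positivity) (by simp) (by norm_num; linarith) ?_
    simp only [Nat.cast_zero, Finset.range_zero, Finset.sum_empty, Nat.sub_zero]
    have e : (2 * (k : ℝ) + 3) * (((3 * (k : ℝ) + 7) ^ 2 - (2 * 0 + 2 * (k : ℝ) + 3) ^ 2) /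
        (2 * (2 * 0 + 2 * (k : ℝ) + 3) * (3 * k + 7))) =
        (k + 4) * (5 * k + 10) / (2 * (3 * k + 7)) := by
      field_simp
      ring
    rw [e]
    have : ((k : ℝ) + 4) * (5 * k + 10) / (2 * (3 * k + 7)) ≤ 3 * k / 4 + 7 - k / 11 := by
      rw [div_le_iff₀ (by positivity)]
      nlinarith
    linarith
  | succ n ih =>
    rw [Finset.sum_range_succ]
    have h1 := logBound_add_one_le (k := k) (n := n) (by positivity) (by positivity)
    push_cast at h1 ⊢
    have h2 : (2 * (n : ℝ) + 1) / (n + k + 2) =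
        ((n : ℝ) + 1) * (1 / ((n : ℝ) + 2 + k)) + n / (n + k + 2) := by
      have e : (n : ℝ) + k + 2 = n + 2 + k := by ring
      rw [e]
      field_simp
      ring
    rcases Nat.lt_or_ge n k with hlt | hge
    · have h3 : ((k - n : ℕ) : ℝ) = ((k - (n + 1) : ℕ) : ℝ) + 1 := by
        have : k - n = k - (n + 1) + 1 := by omega
        exact_mod_cast this
      rw [max_eq_right (by exact_mod_cast hlt.le : (n : ℝ) ≤ k)]
      have h4 : (n : ℝ) / (n + k + 2) ≤ n * (1 / (k + k + 2)) + 1 / 11 := by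
        rw [mul_one_div, div_add_div _ _ (by positivity) (by norm_num),
          div_le_div_iff₀ (by positivity) (by positivity)]
        nlinarith [sq_nonneg (9 * (k : ℝ) - 22 * n), sq_nonneg (n : ℝ)]
      push_cast at ih
      linarith
    · have h3 : k - n = 0 := by omega
      have h4 : k - (n + 1) = 0 := by omega
      rw [h3] at ih
      rw [h4, max_eq_left (by exact_mod_cast hge : (k : ℝ) ≤ n)]
      have h5 : (n : ℝ) * (1 / (n + k + 2)) = n / (n + k + 2) := mul_one_div _ _
      push_cast at ih ⊢
      linarith

/-- If `k` is large compared to `n`, all weights are equal to `1 / (k + 2)`. -/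
theorem sum_eq_of_le {k n : ℕ} (h : 2 * n + 17 ≤ k) :
    ∑ j ∈ Finset.range n,
        (((j : ℝ) + 1) * (2 / ((max (2 * k + 4) (2 * (j + 1) + k + 21) : ℕ) : ℝ)) +
          (j : ℝ) * (2 / ((max (2 * k + 4) (2 * j + k + 21) : ℕ) : ℝ))) =
      (n : ℝ) ^ 2 / ((k : ℝ) + 2) := by
  induction n with
  | zero => simp
  | succ n ih =>
    rw [Finset.sum_range_succ, ih (by omega), max_eq_left (by omega), max_eq_left (by omega)]
    push_cast
    field_simp
    ring

theorem logBound_le_sum_of_large {k : ℕ} (hk : 21 ≤ k) (n : ℕ) (hn : k < 2 * n + 23) :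
    logBound k n ≤ ∑ j ∈ Finset.range n,
        (((j : ℝ) + 1) * (2 / ((max (2 * k + 4) (2 * (j + 1) + k + 21) : ℕ) : ℝ)) +
          (j : ℝ) * (2 / ((max (2 * k + 4) (2 * j + k + 21) : ℕ) : ℝ))) + 2 / ((k : ℝ) + 2) := by
  induction n, (by omega : (k - 21) / 2 ≤ n) using Nat.le_induction with
  | base =>
    set n := (k - 21) / 2 with hn'
    rw [sum_eq_of_le (by omega)]
    have hkn : (k = 2 * n + 21) ∨ (k = 2 * n + 22) := by omega
    have hn0 : (0 : ℝ) ≤ n := by positivity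
    refine logBound_le_of_trapezoid (by positivity) (by positivity) ?_ ?_
    · have : 2 * n ≤ k := by omega
      have : (2 * (n : ℝ)) ≤ k := by exact_mod_cast this
      linarith
    · rcases hkn with h | h
      · have hk' : (k : ℝ) = 2 * n + 21 := by exact_mod_cast h
        have h1 : ((n : ℝ) ^ 2 / (k + 2) + 2 / (k + 2)) =
            n / 2 - 91 / 4 + (136 * n + 2101) / (4 * (2 * n + 23)) := by
          rw [hk']
          field_simp
          ring
        rw [h1, hk']
        have h2 : (2 * (2 * (n : ℝ) + 21) + 3) * (((3 * (2 * (n : ℝ) + 21) + 7) ^ 2 -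
            (2 * n + 2 * (2 * (n : ℝ) + 21) + 3) ^ 2) / (2 * (2 * n + 2 * (2 * (n : ℝ) + 21) + 3) *
              (3 * (2 * (n : ℝ) + 21) + 7))) ≤ (136 * n + 2101) / (4 * (2 * n + 23)) := by
          rw [mul_div_assoc', div_le_div_iff₀ (by positivity) (by positivity), ← sub_nonneg]
          ring_nf
          positivity
        linarith
      · have hk' : (k : ℝ) = 2 * n + 22 := by exact_mod_cast h
        have h1 : ((n : ℝ) ^ 2 / (k + 2) + 2 / (k + 2)) =
            n / 2 - 47 / 2 + (35 * n + 566) / (2 * n + 24) := by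
          rw [hk']
          field_simp
          ring
        rw [h1, hk']
        have h2 : (2 * (2 * (n : ℝ) + 22) + 3) * (((3 * (2 * (n : ℝ) + 22) + 7) ^ 2 -
            (2 * n + 2 * (2 * (n : ℝ) + 22) + 3) ^ 2) / (2 * (2 * n + 2 * (2 * (n : ℝ) + 22) + 3) *
              (3 * (2 * (n : ℝ) + 22) + 7))) ≤ (35 * n + 566) / (2 * n + 24) := by
          rw [mul_div_assoc', div_le_div_iff₀ (by positivity) (by positivity), ← sub_nonneg]
          ring_nf
          positivity
        linarith
  | succ n hle ih =>
    rw [Finset.sum_range_succ]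
    have ih' := ih (by omega)
    have h1 := logBound_add_one_le (k := k) (n := n) (by positivity) (by positivity)
    have hterm : ∀ j : ℕ, j ≤ n + 1 →
        1 / ((n : ℝ) + k + 2) ≤ 2 / ((max (2 * k + 4) (2 * j + k + 21) : ℕ) : ℝ) := by
      intro j hj
      have h2 : max (2 * k + 4) (2 * j + k + 21) ≤ 2 * (n + k + 2) := by omega
      have h3 : ((max (2 * k + 4) (2 * j + k + 21) : ℕ) : ℝ) ≤ 2 * ((n : ℝ) + k + 2) := by
        exact_mod_cast h2
      have h4 : (0 : ℝ) < ((max (2 * k + 4) (2 * j + k + 21) : ℕ) : ℝ) := by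
        have : 0 < max (2 * k + 4) (2 * j + k + 21) := by omega
        exact_mod_cast this
      rw [div_le_div_iff₀ (by positivity) h4]
      linarith
    have h2 := mul_le_mul_of_nonneg_left (hterm (n + 1) le_rfl) (by positivity : (0 : ℝ) ≤ n + 1)
    have h3 := mul_le_mul_of_nonneg_left (hterm n (by omega)) (by positivity : (0 : ℝ) ≤ n)
    have h4 : (2 * (n : ℝ) + 1) / (n + k + 2) =
        ((n : ℝ) + 1) * (1 / (n + k + 2)) + n * (1 / (n + k + 2)) := by
      ring
    have e : ((n + 1 : ℕ) : ℝ) = n + 1 := by push_cast; rfl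
    rw [e]
    linarith

end Comparison

end LiminalBurning

theorem mainTheorem3 (k n : ℕ) (hk : 1 ≤ k) (hn : 1 ≤ n) :
    (k = 1 →
      2 * (n : ℝ) - 2 * (⌊Real.logb 2 ((n : ℝ) + 3)⌋ : ℝ)
        ≤ (LiminalBurning.liminalBurningNumber (LiminalBurning.grid n) k : ℝ)) ∧
    (2 ≤ k → k < 2 * n + 23 →
      2 * (n : ℝ) - 3 * (k : ℝ) / 4 - 7
          - (2 * (k : ℝ) + 3)
            * Real.log ((2 * (n : ℝ) + 2 * (k : ℝ) + 3) / (3 * (k : ℝ) + 7))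
        ≤ (LiminalBurning.liminalBurningNumber (LiminalBurning.grid n) k : ℝ)) ∧
    (2 * n + 23 ≤ k → (k : ℝ) < (2 / 3 : ℝ) ^ (1 / 3 : ℝ) * (n : ℝ) ^ (4 / 3 : ℝ) →
      ((n : ℝ) ^ 2 + 2) / ((k : ℝ) + 2)
        ≤ (LiminalBurning.liminalBurningNumber (LiminalBurning.grid n) k : ℝ)) ∧
    ((2 / 3 : ℝ) ^ (1 / 3 : ℝ) * (n : ℝ) ^ (4 / 3 : ℝ) ≤ (k : ℝ) →
      (3 / 2 : ℝ) ^ (1 / 3 : ℝ) * (n : ℝ) ^ (2 / 3 : ℝ) - 1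
        ≤ (LiminalBurning.liminalBurningNumber (LiminalBurning.grid n) k : ℝ)) := by
  refine ⟨?_, fun h2 hkn => ?_, fun hkn _ => ?_,
    fun _ => LiminalBurning.rpow_le_liminalBurningNumber hk hn⟩
  · rintro rfl
    exact LiminalBurning.two_mul_sub_log_le_liminalBurningNumber hn
  · rcases Nat.lt_or_ge k 21 with h | h
    · refine (LiminalBurning.logBound_le_sum_of_small h2 (by omega) n).trans ?_
      have := LiminalBurning.sum_le_liminalBurningNumber_of_small hk hn
      have h3 : (0 : ℝ) ≤ ((k - n : ℕ) : ℝ) / 11 := by positivity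
      linarith
    · exact (LiminalBurning.logBound_le_sum_of_large h n hkn).trans
        (LiminalBurning.sum_le_liminalBurningNumber_of_large h hn)
  · have := LiminalBurning.sum_le_liminalBurningNumber_of_large (k := k) (by omega) hn
    rwa [LiminalBurning.sum_eq_of_le (by omega), ← add_div] at this
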